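/- Let $D$ be a finite simple digraph (no self loops and no multiple arcs; the two opposite arcs $\langle u,v\rangle$ and $\langle v,u\rangle$ may both be present) on $n > 2$ vertices. Write $d^+(u)$ for the number of arcs leaving $u$ and $d^-(v)$ for the number of arcs entering $v$. Suppose that $d^+(u) + d^-(v) \ge n + 2$ for all pairs of distinct vertices $u, v$ such that $\langle u, v\rangle$ is not an arc of $D$. Then $D$ contains at least two arc-disjoint Hamiltonian cycles, that is, two directed cycles through all the vertices of $D$ that have no arc in common. -/

import Mathlib

namespace Digraph

variable {V : Type*}

/-- The digraph has no self loops. (Parallel arcs cannot occur, as arcs are given by a relation.) -/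
def IsSimple (D : Digraph V) : Prop := ∀ v, ¬ D.Adj v v

/-- `d⁺(v)`: the number of arcs leaving `v`. -/
noncomputable def outDeg (D : Digraph V) (v : V) : ℕ := {w | D.Adj v w}.ncard

/-- `d⁻(v)`: the number of arcs entering `v`. -/
noncomputable def inDeg (D : Digraph V) (v : V) : ℕ := {u | D.Adj u v}.ncard

/-- `C` is the arc set of a directed Hamiltonian cycle of `D`: every element of `C` is an arc
of `D`, and for some enumeration `v₀, …, vₙ₋₁` of all vertices (each listed exactly once), `C`
consists of the pairs `(v₀, v₁), …, (vₙ₋₂, vₙ₋₁), (vₙ₋₁, v₀)`. -/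
def IsHamiltonianCycle [Fintype V] (D : Digraph V) (C : Set (V × V)) : Prop :=
  (∀ a ∈ C, D.Adj a.1 a.2) ∧
    ∃ e : Fin (Fintype.card V) ≃ V, C = Set.range fun i => (e i, e (finRotate _ i))

end Digraph

/-! Fix a permutation `π` that runs once around all the vertices, and delete from `D` the arcs `⟨v,
π v⟩`. Each out-degree and each in-degree drops by at most 1, so the remaining relation `A`
satisfies Ore's condition with bound `n` for every non-adjacent pair except possibly the pairs `(v,
π v)`. The core is that such an `A` has a Hamiltonian cycle when `n ≥ 4`
(`IsOreOff.exists_spanning`). This is used twice: with an arbitrary cyclic `π`, whose arcs need not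
lie in `D`, to get a first cycle, and then with `π` the successor map of that cycle, to get a second
one disjoint from it.

For the core, take a longest cycle and a vertex `z` off it. Leave the cycle towards `z`, come back
further on, and swap two segments to pick up the skipped vertices: if this is possible, the cycle
was not longest (`not_exchange`). Counting attachments of `z` and arcs at the two ends of the
skipped segment would rule out `z` under the full Ore condition. Here the exceptional pairs leave
exactly the equality case, recorded in `IsTight`. It forces `z` to be the only vertex off the cycle.
A further exchange puts `z` on the cycle and drops a vertex `v` of larger total degree
(`IsTight.exists_larger`), which is impossible if `z` was chosen of maximal total degree among
vertices missed by a longest cycle. -/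

namespace Digraph

/-! ### Cycles as periodic sequences, and surgery on them -/

section CyclicWalk

variable {V : Type*} {A : V → V → Prop}

/-- `x` runs periodically around a directed cycle with `m` vertices of the relation `A`. -/
structure IsCyclicWalk (A : V → V → Prop) (m : ℕ) (x : ℕ → V) : Prop where
  pos : 0 < m
  periodic : ∀ k, x (k + m) = x k
  adj : ∀ k, A (x k) (x (k + 1))
  inj : ∀ j < m, ∀ k < m, x j = x k → j = k

/-- `l` lists the vertices of a directed walk of `A` from `a` to `b`. -/
structure IsWalk (A : V → V → Prop) (a b : V) (l : List V) : Prop where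
  chain : l.IsChain A
  head : l.head? = some a
  last : l.getLast? = some b

theorem IsWalk.append {a b c d : V} {l₁ l₂ : List V} (h₁ : IsWalk A a b l₁) (h : A b c)
    (h₂ : IsWalk A c d l₂) : IsWalk A a d (l₁ ++ l₂) := by
  refine ⟨List.isChain_append.2 ⟨h₁.chain, h₂.chain, ?_⟩, ?_, ?_⟩
  · intro u hu v hv
    rw [h₁.last] at hu
    rw [h₂.head] at hv
    simp only [Option.mem_def, Option.some.injEq] at hu hv
    subst hu hv
    exact h
  · simp [List.head?_append, h₁.head]
  · simp [List.getLast?_append, h₂.last]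

theorem IsWalk.singleton (a : V) : IsWalk A a a [a] := ⟨by simp, rfl, rfl⟩

/-- The vertices `x j, …, x k`. -/
def segment (x : ℕ → V) (j k : ℕ) : List V := (List.range' j (k + 1 - j)).map x

theorem mem_segment {x : ℕ → V} {j k : ℕ} {v : V} :
    v ∈ segment x j k ↔ ∃ t, j ≤ t ∧ t ≤ k ∧ x t = v := by
  simp only [segment, List.mem_map, List.mem_range'_1]
  constructor
  · rintro ⟨t, ht, rfl⟩
    exact ⟨t, by omega, by omega, rfl⟩
  · rintro ⟨t, h₁, h₂, rfl⟩
    exact ⟨t, by omega, rfl⟩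

theorem length_segment (x : ℕ → V) (j k : ℕ) : (segment x j k).length = k + 1 - j := by
  simp [segment]

theorem isWalk_segment {x : ℕ → V} (h : ∀ k, A (x k) (x (k + 1))) {j k : ℕ} (hjk : j ≤ k) :
    IsWalk A (x j) (x k) (segment x j k) := by
  obtain ⟨d, rfl⟩ := Nat.exists_eq_add_of_le hjk
  induction d with
  | zero => simpa [segment] using IsWalk.singleton (x j)
  | succ d ih =>
    have e : segment x j (j + (d + 1)) = segment x j (j + d) ++ [x (j + d + 1)] := by
      simp only [segment]
      rw [show j + (d + 1) + 1 - j = (j + d + 1 - j) + 1 by omega, List.range'_concat]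
      simp only [List.map_append, List.map_cons, List.map_nil, one_mul]
      rw [show j + (j + d + 1 - j) = j + d + 1 by omega]
    rw [e]
    exact (ih (by omega)).append (h _) (IsWalk.singleton _)

namespace IsCyclicWalk

variable {m : ℕ} {x : ℕ → V}

theorem apply_mod (h : IsCyclicWalk A m x) (k : ℕ) : x (k % m) = x k := by
  have : ∀ c r, x (r + m * c) = x r := by
    intro c
    induction c with
    | zero => simp
    | succ c ih => intro r; rw [Nat.mul_succ, ← add_assoc, h.periodic, ih]
  conv_rhs => rw [← Nat.mod_add_div k m]
  exact (this _ _).symm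

theorem rotate (h : IsCyclicWalk A m x) (q : ℕ) : IsCyclicWalk A m fun k => x (k + q) where
  pos := h.pos
  periodic k := by rw [show k + m + q = k + q + m by omega, h.periodic]
  adj k := by rw [show k + 1 + q = k + q + 1 by omega]; exact h.adj _
  inj j hj k hk e := by
    have e' : x ((j + q) % m) = x ((k + q) % m) := by rw [h.apply_mod, h.apply_mod]; exact e
    have := h.inj _ (Nat.mod_lt _ h.pos) _ (Nat.mod_lt _ h.pos) e'
    have h2 : j ≡ k [MOD m] := Nat.ModEq.add_right_cancel' q this
    exact Nat.ModEq.eq_of_lt_of_lt h2 hj hk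

theorem inj_window (h : IsCyclicWalk A m x) {q j k : ℕ} (hj : q ≤ j) (hj' : j < q + m)
    (hk : q ≤ k) (hk' : k < q + m) (e : x j = x k) : j = k := by
  have := (h.rotate q).inj (j - q) (by omega) (k - q) (by omega)
    (by simpa [Nat.sub_add_cancel hj, Nat.sub_add_cancel hk] using e)
  omega

theorem nodup_segment (h : IsCyclicWalk A m x) {j k : ℕ} (hk : k < j + m) :
    (segment x j k).Nodup := by
  refine List.Nodup.map_on ?_ List.nodup_range'
  intro s hs t ht e
  rw [List.mem_range'_1] at hs ht
  exact h.inj_window (q := j) (by omega) (by omega) (by omega) (by omega) e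

theorem exists_lt (h : IsCyclicWalk A m x) (k : ℕ) : ∃ t < m, x t = x k :=
  ⟨k % m, Nat.mod_lt _ h.pos, h.apply_mod k⟩

theorem of_list {a b : V} {l : List V} (hl : IsWalk A a b l) (hd : l.Nodup) (hba : A b a) :
    ∃ y, IsCyclicWalk A l.length y ∧ ∀ k, y k ∈ l := by
  have hne : l ≠ [] := by rintro rfl; simpa using hl.head
  have hpos : 0 < l.length := List.length_pos_iff.2 hne
  refine ⟨fun k => l[k % l.length]'(Nat.mod_lt _ hpos), ⟨hpos, ?_, ?_, ?_⟩, ?_⟩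
  · intro k
    simp
  · intro k
    have hk := Nat.mod_lt k hpos
    by_cases hc : k % l.length + 1 < l.length
    · have e : (k + 1) % l.length = k % l.length + 1 := by
        rw [Nat.add_mod, Nat.mod_eq_of_lt (a := 1) (by omega), Nat.mod_eq_of_lt hc]
      simp only [e]
      exact List.isChain_iff_getElem.1 hl.chain _ hc
    · have e : (k + 1) % l.length = 0 := by
        have : k % l.length + 1 = l.length := by omega
        rw [← Nat.mod_add_mod, this, Nat.mod_self]
      have e' : k % l.length = l.length - 1 := by omega
      simp only [e, e']
      have h1 := hl.head
      have h2 := hl.last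
      rw [List.head?_eq_getElem?, List.getElem?_eq_getElem hpos, Option.some.injEq] at h1
      rw [List.getLast?_eq_getElem?, List.getElem?_eq_getElem (by omega), Option.some.injEq] at h2
      rw [h1, h2]
      exact hba
  · intro j hj k hk e
    simp only [Nat.mod_eq_of_lt hj, Nat.mod_eq_of_lt hk] at e
    exact (List.Nodup.getElem_inj_iff hd).1 e
  · intro k
    exact List.getElem_mem _

/-- A path outside the cycle from `x (q + m - 1)` back to `x q` lengthens the cycle. -/
theorem insert (h : IsCyclicWalk A m x) {q : ℕ} {u v : V} {Z : List V} (hZ : IsWalk A u v Z)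
    (hZd : Z.Nodup) (hZx : ∀ k, x k ∉ Z) (hu : A (x (q + m - 1)) u) (hv : A v (x q)) :
    ∃ y, IsCyclicWalk A (m + Z.length) y := by
  have hm := h.pos
  have hw := (isWalk_segment h.adj (show q ≤ q + m - 1 by omega)).append hu hZ
  have hd : (segment x q (q + m - 1) ++ Z).Nodup := by
    refine List.nodup_append.2 ⟨h.nodup_segment (by omega), hZd, ?_⟩
    rintro a ha b hb rfl
    obtain ⟨t, -, -, rfl⟩ := mem_segment.1 ha
    exact hZx t hb
  obtain ⟨y, hy, -⟩ := of_list hw hd hv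
  refine ⟨y, ?_⟩
  convert hy using 1
  rw [List.length_append, length_segment]
  omega

/-- The exchange of segments: `[i+1..l], [q..i], [l'..q+m-1]`, followed by a path outside. -/
theorem exchange (h : IsCyclicWalk A m x) {q i l l' : ℕ} (hqi : q ≤ i) (hil : i < l)
    (hll : l < l') (hl' : l' < q + m) {u v : V} {Z : List V} (hZ : IsWalk A u v Z)
    (hZd : Z.Nodup) (hZx : ∀ k, x k ∉ Z) (hu : A (x (q + m - 1)) u) (hv : A v (x (i + 1)))
    (h₁ : A (x l) (x q)) (h₂ : A (x i) (x l')) :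
    ∃ y, IsCyclicWalk A (m + Z.length + l + 1 - l') y ∧
      ∀ k, y k ∈ Z ∨ ∃ t, q ≤ t ∧ t < q + m ∧ (t ≤ l ∨ l' ≤ t) ∧ x t = y k := by
  have hm := h.pos
  have hw := (((isWalk_segment h.adj (show i + 1 ≤ l by omega)).append h₁
    (isWalk_segment h.adj hqi)).append h₂
    (isWalk_segment h.adj (show l' ≤ q + m - 1 by omega))).append hu hZ
  have hdis : ∀ {j k j' k' : ℕ}, q ≤ j → k < q + m → q ≤ j' → k' < q + m →
      (k < j' ∨ k' < j) → ∀ a ∈ segment x j k, ∀ b ∈ segment x j' k', a ≠ b := by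
    rintro j k j' k' a1 a2 a3 a4 a5 a ha b hb rfl
    obtain ⟨t, t1, t2, rfl⟩ := mem_segment.1 ha
    obtain ⟨s, s1, s2, e⟩ := mem_segment.1 hb
    have := h.inj_window (q := q) (by omega) (by omega) (by omega) (by omega) e
    omega
  have hd : (segment x (i + 1) l ++ segment x q i ++ segment x l' (q + m - 1) ++ Z).Nodup := by
    refine List.nodup_append.2 ⟨List.nodup_append.2 ⟨List.nodup_append.2
      ⟨h.nodup_segment (by omega), h.nodup_segment (by omega), ?_⟩,
      h.nodup_segment (by omega), ?_⟩, hZd, ?_⟩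
    · exact hdis (by omega) (by omega) (by omega) (by omega) (by omega)
    · intro a ha
      rcases List.mem_append.1 ha with ha | ha
      · exact hdis (by omega) (by omega) (by omega) (by omega) (by omega) a ha
      · exact hdis (by omega) (by omega) (by omega) (by omega) (by omega) a ha
    · rintro a ha b hb rfl
      simp only [List.mem_append, mem_segment] at ha
      rcases ha with (⟨t, -, -, rfl⟩ | ⟨t, -, -, rfl⟩) | ⟨t, -, -, rfl⟩ <;> exact hZx t hb
  obtain ⟨y, hy, hyl⟩ := of_list hw hd hv
  refine ⟨y, ?_, fun k => ?_⟩
  · convert hy using 1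
    simp only [List.length_append, length_segment]
    omega
  · have := hyl k
    simp only [List.mem_append, mem_segment] at this
    rcases this with ((⟨t, t1, t2, e⟩ | ⟨t, t1, t2, e⟩) | ⟨t, t1, t2, e⟩) | hz
    · exact Or.inr ⟨t, by omega, by omega, by omega, e⟩
    · exact Or.inr ⟨t, by omega, by omega, by omega, e⟩
    · exact Or.inr ⟨t, by omega, by omega, by omega, e⟩
    · exact Or.inl hz

end IsCyclicWalk

theorem exists_nodup_isWalk {P : V → Prop} {a b : V}
    (h : Relation.ReflTransGen (fun u v => A u v ∧ P u ∧ P v) a b) (hb : P b) :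
    ∃ l, IsWalk A a b l ∧ l.Nodup ∧ ∀ w ∈ l, P w := by
  induction h using Relation.ReflTransGen.head_induction_on with
  | refl => exact ⟨[b], IsWalk.singleton b, by simp, by simpa⟩
  | @head a c hac _ ih =>
    obtain ⟨l, hl, hd, hP⟩ := ih
    -- If `a` recurs, the loop is cut off by restarting at its occurrence in `l`.
    by_cases ha : a ∈ l
    · obtain ⟨s, t, rfl⟩ := List.append_of_mem ha
      refine ⟨a :: t, ⟨(List.isChain_append.1 hl.chain).2.1, rfl, ?_⟩,
        (List.nodup_append.1 hd).2.1, fun w hw => hP w (List.mem_append_right _ hw)⟩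
      simpa [List.getLast?_append] using hl.last
    · refine ⟨[a] ++ l, (IsWalk.singleton a).append hac.1 hl, by simp [ha, hd], ?_⟩
      simpa using ⟨hac.2.1, hP⟩

end CyclicWalk

/-! ### The counting argument behind the exchange -/

open Finset in
open Classical in
theorem sum_indicator_le_one {i : ℕ} {a : ℕ → Prop}
    (h : ∀ j < i, ∀ k < i, a j → a k → j = k) : ∑ k ∈ range i, (if a k then 1 else 0) ≤ 1 := by
  rw [← card_filter, card_le_one]
  simp only [mem_filter, mem_range]
  exact fun j hj k hk => h j hj.1 k hk.1 hj.2 hk.2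

open Classical in
theorem indicator_add_eq_one {P Q : Prop} (h : ¬(P ∧ Q)) :
    (if P then 1 else 0) + (if Q then 1 else 0) + (if P ∨ Q then 0 else 1) = 1 := by
  by_cases hP : P <;> by_cases hQ : Q <;> simp_all

open Finset in
open Classical in
/-- Counting positions on a cycle of length `i + g + 2`: `w` and `o` are the positions joined to a
start and reached from an end, `a` and `b` those entering and entered from outside. -/
theorem exchange_count {i g : ℕ} {w o a b : ℕ → Prop} (hw0 : ¬w 0) (hoi : ¬o i)
    (hwo : ∀ j < g, ¬(w (i + 1 + j) ∧ o (i + 2 + j)))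
    (hab : ∀ j < g + 1, ¬(a (i + j) ∧ b (i + 1 + j))) (hb0 : ¬b 0)
    (hwb : i + g + 3 ≤ #{l ∈ range (i + g + 2) | w l} + #{l ∈ range (i + g + 2) | b l})
    (hoa : i + g + 3 ≤ #{l ∈ range (i + g + 2) | o l} + #{l ∈ range (i + g + 2) | a l})
    (ha : ∀ j < i, ∀ k < i, a j → a k → j = k)
    (hb : ∀ j < i, ∀ k < i, b (1 + j) → b (1 + k) → j = k) :
    (∃ p < i, a p) ∧ (∃ p < i, b (1 + p)) ∧ (∀ j < i, w (1 + j)) ∧ (∀ j < i, o j) ∧ o (i + 1) ∧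
      (∀ j < g, w (i + 1 + j) ∨ o (i + 2 + j)) ∧ (∀ j < g + 1, a (i + j) ∨ b (i + 1 + j)) := by
  -- The four counts add up to at least `2 * (i + g + 3)`. The bounds below add up to exactly the
  -- same number, so each is attained, and the conclusions are the equality cases.
  have ha' := sum_indicator_le_one ha
  have hb' := sum_indicator_le_one hb
  have hW : #{l ∈ range (i + g + 2) | w l} + ∑ j ∈ range i, (if w (1 + j) then 0 else 1) ≤
      i + (∑ j ∈ range g, if w (i + 1 + j) then 1 else 0) + 1 := by
    rw [card_filter, show i + g + 2 = 1 + i + g + 1 by omega, sum_range_succ, sum_range_add,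
      sum_range_add]
    have h1 : (∑ j ∈ range i, if w (1 + j) then 1 else 0) +
        ∑ j ∈ range i, (if w (1 + j) then 0 else 1) = i := by
      rw [← sum_add_distrib, sum_congr rfl (g := fun _ => 1) (fun j _ => by split_ifs <;> rfl)]
      simp
    have h2 : (if w (1 + i + g) then 1 else 0) ≤ 1 := by split_ifs <;> omega
    simp only [sum_range_one, if_neg hw0, add_comm i 1] at h1 h2 ⊢
    omega
  have hO : #{l ∈ range (i + g + 2) | o l} + ∑ j ∈ range i, (if o j then 0 else 1) +
      (if o (i + 1) then 0 else 1) ≤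
      i + 1 + (∑ j ∈ range g, if o (i + 2 + j) then 1 else 0) := by
    rw [card_filter, show i + g + 2 = i + 2 + g by omega, sum_range_add, sum_range_succ,
      sum_range_succ]
    have h1 : (∑ j ∈ range i, if o j then 1 else 0) +
        ∑ j ∈ range i, (if o j then 0 else 1) = i := by
      rw [← sum_add_distrib, sum_congr rfl (g := fun _ => 1) (fun j _ => by split_ifs <;> rfl)]
      simp
    have h2 : (if o (i + 1) then 1 else 0) + (if o (i + 1) then 0 else 1) = 1 := by
      split_ifs <;> omega
    simp only [if_neg hoi]
    omega
  have hG : (∑ j ∈ range g, if w (i + 1 + j) then 1 else 0) +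
      (∑ j ∈ range g, if o (i + 2 + j) then 1 else 0) +
      (∑ j ∈ range g, if w (i + 1 + j) ∨ o (i + 2 + j) then 0 else 1) = g := by
    rw [← sum_add_distrib, ← sum_add_distrib, sum_congr rfl (g := fun _ => 1)]
    · simp
    · intro j hj
      exact indicator_add_eq_one (hwo j (mem_range.1 hj))
  have hF : (∑ j ∈ range (g + 1), if a (i + j) then 1 else 0) +
      (∑ j ∈ range (g + 1), if b (i + 1 + j) then 1 else 0) +
      (∑ j ∈ range (g + 1), if a (i + j) ∨ b (i + 1 + j) then 0 else 1) = g + 1 := by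
    rw [← sum_add_distrib, ← sum_add_distrib, sum_congr rfl (g := fun _ => 1)]
    · simp
    · intro j hj
      exact indicator_add_eq_one (hab j (mem_range.1 hj))
  have hA : #{l ∈ range (i + g + 2) | a l} ≤ (∑ j ∈ range i, if a j then 1 else 0) +
      (∑ j ∈ range (g + 1), if a (i + j) then 1 else 0) + 1 := by
    rw [card_filter, show i + g + 2 = i + (g + 1) + 1 by omega, sum_range_succ, sum_range_add]
    split_ifs <;> omega
  have hB : #{l ∈ range (i + g + 2) | b l} = (∑ j ∈ range i, if b (1 + j) then 1 else 0) +
      (∑ j ∈ range (g + 1), if b (i + 1 + j) then 1 else 0) := by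
    rw [card_filter, show i + g + 2 = 1 + i + (g + 1) by omega, sum_range_add, sum_range_add]
    simp only [sum_range_one, if_neg hb0, add_comm i 1, zero_add]
  have zero : ∀ {N : ℕ} {P : ℕ → Prop} [DecidablePred P], ∑ j ∈ range N, (if P j then 0 else 1) = 0 →
      ∀ j < N, P j := by
    intro N P _ h j hj
    by_contra hP
    have := (sum_eq_zero_iff.1 h) j (mem_range.2 hj)
    simp [hP] at this
  have one : ∀ {N : ℕ} {P : ℕ → Prop}, 0 < ∑ j ∈ range N, (if P j then 1 else 0) →
      ∃ j < N, P j := by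
    intro N P h
    by_contra hP
    push Not at hP
    rw [sum_eq_zero] at h
    · omega
    · intro j hj
      simp [hP j (mem_range.1 hj)]
  refine ⟨one (by omega), one (P := fun j => b (1 + j)) (by omega),
    zero (P := fun j => w (1 + j)) (by omega), zero (by omega), ?_,
    zero (P := fun j => w (i + 1 + j) ∨ o (i + 2 + j)) (by omega),
    zero (P := fun j => a (i + j) ∨ b (i + 1 + j)) (by omega)⟩
  by_contra h
  rw [if_neg h] at hO
  omega

/-! ### Ore's condition off a derangement -/

section OreCondition

open Finset Relation
open scoped Classical

variable {V : Type*} [Fintype V] {A : V → V → Prop} {π : Equiv.Perm V}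

/-- A loopless relation avoiding the graph of a derangement `π`, in which all further non-adjacent
pairs satisfy an Ore condition. -/
structure IsOreOff (A : V → V → Prop) (π : Equiv.Perm V) : Prop where
  card : 4 ≤ Fintype.card V
  irrefl : ∀ v, ¬A v v
  ne : ∀ v, π v ≠ v
  not_adj : ∀ v, ¬A v (π v)
  ore : ∀ u v, u ≠ v → ¬A u v → π u ≠ v → Fintype.card V ≤ #{w | A u w} + #{w | A w v}

theorem IsOreOff.symm (H : IsOreOff A π) : IsOreOff (fun u v => A v u) π⁻¹ where
  card := H.card
  irrefl := H.irrefl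
  ne v h := H.ne v (by rw [Equiv.Perm.inv_eq_iff_eq] at h; exact h.symm)
  not_adj v h := H.not_adj (π⁻¹ v) (by simpa using h)
  ore u v huv h hp := by
    rw [add_comm]
    exact H.ore v u huv.symm h fun e => hp (by rw [← e]; simp)

/-- A set with at least two vertices outside is entered from at least two of them. -/
theorem IsOreOff.two_le_card_entering (H : IsOreOff A π) {T : Finset V} (hT : T.Nonempty)
    (hT' : 2 ≤ #Tᶜ) : 2 ≤ #{u ∈ Tᶜ | ∃ t ∈ T, A u t} := by
  by_contra hI
  set I := {u ∈ Tᶜ | ∃ t ∈ T, A u t} with hIdef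
  have hIT : I ⊆ Tᶜ := filter_subset _ _
  have hc := card_compl_add_card T
  have hY : #(Tᶜ \ I) + #I = #Tᶜ := card_sdiff_add_card_eq_card hIT
  -- With `#I ≤ 1`, the out-degree of `u` and the in-degree of `t` add up to less than `n`, so only
  -- an exceptional pair is possible. Since `π` is an injective function, `T` and `Tᶜ \ I` are then
  -- singletons and `n ≤ 3`.
  have key : ∀ u ∈ Tᶜ \ I, ∀ t ∈ T, π u = t := by
    intro u hu t ht
    by_contra hp
    rw [mem_sdiff, mem_compl] at hu
    have hno : ∀ t ∈ T, ¬A u t := by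
      intro t ht h
      exact hu.2 (by rw [hIdef, mem_filter, mem_compl]; exact ⟨hu.1, t, ht, h⟩)
    have h := H.ore u t (by rintro rfl; exact hu.1 ht) (hno t ht) hp
    have h1 : #{w | A u w} ≤ #(Tᶜ.erase u) := by
      refine card_le_card fun w hw => ?_
      rw [mem_filter] at hw
      rw [mem_erase, mem_compl]
      exact ⟨by rintro rfl; exact H.irrefl _ hw.2, fun h => hno w h hw.2⟩
    have h2 : #{w | A w t} ≤ #(T.erase t ∪ I) := by
      refine card_le_card fun w hw => ?_
      rw [mem_filter] at hw
      rw [mem_union, mem_erase]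
      by_cases hwT : w ∈ T
      · exact Or.inl ⟨by rintro rfl; exact H.irrefl _ hw.2, hwT⟩
      · exact Or.inr (by rw [hIdef, mem_filter, mem_compl]; exact ⟨hwT, t, ht, hw.2⟩)
    have h3 := card_union_le (T.erase t) I
    rw [card_erase_of_mem ht] at h3
    rw [card_erase_of_mem (mem_compl.2 hu.1)] at h1
    have := hT.card_pos
    omega
  have hYpos : 0 < #(Tᶜ \ I) := by omega
  obtain ⟨u, hu⟩ := card_pos.1 hYpos
  obtain ⟨t, ht⟩ := hT
  have h1 : #(Tᶜ \ I) ≤ 1 := card_le_one.2 fun a ha b hb =>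
    π.injective ((key a ha t ht).trans (key b hb t ht).symm)
  have h2 : #T ≤ 1 := card_le_one.2 fun a ha b hb => (key u hu a ha).symm.trans (key u hu b hb)
  have := H.card
  omega

theorem IsOreOff.two_le_card_leaving (H : IsOreOff A π) {T : Finset V} (hT : T.Nonempty)
    (hT' : 2 ≤ #Tᶜ) : 2 ≤ #{u ∈ Tᶜ | ∃ t ∈ T, A t u} :=
  H.symm.two_le_card_entering hT hT'

/-! ### Longest cycles and the vertices they miss -/

/-- `x` runs around a longest cycle, with vertex set `C`. -/
structure IsLongestCycle (A : V → V → Prop) (C : Finset V) (m : ℕ) (x : ℕ → V) : Prop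
    extends IsCyclicWalk A m x where
  mem : ∀ v, v ∈ C ↔ ∃ k, x k = v
  max : ∀ m' y, IsCyclicWalk A m' y → m' ≤ m

/-- Reachability by walks outside `C`. -/
def ReachOff (A : V → V → Prop) (C : Finset V) : V → V → Prop :=
  ReflTransGen fun u v => A u v ∧ u ∉ C ∧ v ∉ C

/-- From `a` one can leave `C` and reach `z`. -/
def Enters (A : V → V → Prop) (C : Finset V) (z a : V) : Prop :=
  ∃ v ∉ C, A a v ∧ ReachOff A C v z

/-- From `z` one can reach `b`, running outside `C` before. -/
def Leaves (A : V → V → Prop) (C : Finset V) (z b : V) : Prop :=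
  ∃ v ∉ C, ReachOff A C z v ∧ A v b

namespace IsLongestCycle

variable {C : Finset V} {m : ℕ} {x : ℕ → V} {z : V}

omit [Fintype V] in
theorem apply_mem (L : IsLongestCycle A C m x) (k : ℕ) : x k ∈ C := (L.mem _).2 ⟨k, rfl⟩

omit [Fintype V] in
theorem shift (L : IsLongestCycle A C m x) (q : ℕ) :
    IsLongestCycle A C m fun k => x (k + q) where
  toIsCyclicWalk := L.rotate q
  mem v := by
    rw [L.mem]
    constructor
    · rintro ⟨k, rfl⟩
      refine ⟨k + (m * q - q), ?_⟩
      have : q ≤ m * q := Nat.le_mul_of_pos_left _ L.pos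
      rw [show k + (m * q - q) + q = k + m * q by omega, ← L.apply_mod (k + m * q),
        Nat.add_mul_mod_self_left, L.apply_mod]
    · rintro ⟨k, rfl⟩
      exact ⟨_, rfl⟩
  max := L.max

omit [Fintype V] in
theorem eq_image (L : IsLongestCycle A C m x) : C = (range m).image x := by
  ext v
  rw [L.mem, mem_image]
  constructor
  · rintro ⟨k, rfl⟩
    obtain ⟨t, ht, e⟩ := L.exists_lt k
    exact ⟨t, mem_range.2 ht, e⟩
  · rintro ⟨k, -, e⟩
    exact ⟨k, e⟩

omit [Fintype V] in
theorem card_filter (L : IsLongestCycle A C m x) (P : V → Prop) :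
    #{v ∈ C | P v} = #{k ∈ range m | P (x k)} := by
  rw [L.eq_image, filter_image, card_image_of_injOn]
  intro j hj k hk e
  rw [mem_coe, mem_filter, mem_range] at hj hk
  exact L.inj j hj.1 k hk.1 e

omit [Fintype V] in
theorem card_eq (L : IsLongestCycle A C m x) : #C = m := by
  simpa using L.card_filter fun _ => True

theorem card_filter_univ (L : IsLongestCycle A C m x) (P : V → Prop) :
    #{v | P v} = #{k ∈ range m | P (x k)} + #{v ∈ Cᶜ | P v} := by
  rw [← L.card_filter, ← card_union_of_disjoint]
  · congr 1
    ext v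
    simp only [mem_filter, mem_univ, true_and, mem_union, mem_compl]
    tauto
  · exact disjoint_filter_filter disjoint_compl_right

-- A detour between consecutive vertices of the cycle would lengthen it.
omit [Fintype V] in
theorem not_bridge (L : IsLongestCycle A C m x) (q : ℕ) {u v : V} (hu : u ∉ C)
    (huv : ReachOff A C u v) (h₁ : A (x (q + m - 1)) u) (h₂ : A v (x q)) : False := by
  have hv : v ∉ C := by
    cases huv with
    | refl => exact hu
    | tail _ h => exact h.2.2
  obtain ⟨Z, hZ, hd, hP⟩ := exists_nodup_isWalk huv hv
  obtain ⟨y, hy⟩ := L.insert hZ hd (fun k hk => hP _ hk (L.apply_mem k)) h₁ h₂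
  have h1 := L.max _ _ hy
  have h2 : Z.length ≠ 0 := by
    intro h
    rw [List.length_eq_zero_iff] at h
    subst h
    simpa using hZ.head
  omega

omit [Fintype V] in
theorem not_enters_leaves (L : IsLongestCycle A C m x) {k : ℕ} (h₁ : Enters A C z (x k))
    (h₂ : Leaves A C z (x (k + 1))) : False := by
  obtain ⟨u, hu, h, huz⟩ := h₁
  obtain ⟨v, -, hzv, h'⟩ := h₂
  refine L.not_bridge (k + 1) hu (huz.trans hzv) ?_ h'
  rwa [show k + 1 + m - 1 = k + m by omega, L.periodic]

-- The cycle `[i+1..l], [q..i], [l+1..q+m-1]`, closed up through `z`, would keep all of `C` and add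
-- at least one vertex.
omit [Fintype V] in
theorem not_exchange (L : IsLongestCycle A C m x) {q i l : ℕ} (hqi : q ≤ i) (hil : i < l)
    (hl : l + 1 < q + m) (h₁ : Enters A C z (x (q + m - 1))) (h₂ : Leaves A C z (x (i + 1)))
    (h₃ : A (x l) (x q)) (h₄ : A (x i) (x (l + 1))) : False := by
  obtain ⟨u, hu, h, huz⟩ := h₁
  obtain ⟨v, hv, hzv, h'⟩ := h₂
  obtain ⟨Z, hZ, hd, hP⟩ := exists_nodup_isWalk (huz.trans hzv) hv
  obtain ⟨y, hy, -⟩ := L.exchange hqi hil (Nat.lt_succ_self l) hl hZ hd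
    (fun k hk => hP _ hk (L.apply_mem k)) h h' h₃ h₄
  have h1 := L.max _ _ hy
  have h2 : Z.length ≠ 0 := by
    intro h
    rw [List.length_eq_zero_iff] at h
    subst h
    simpa using hZ.head
  omega

/-- Ore's condition applies to `k` and `x q`. Off `C`, the out-neighbours of `k` and the
in-neighbours of `x q` are disjoint and avoid `k`, by maximality of the cycle, so they account for
at most `n - m - 1`; the rest lies on the cycle. -/
theorem card_into_first (L : IsLongestCycle A C m x) (H : IsOreOff A π) {q : ℕ} {k : V}
    (h : Enters A C z (x (q + m - 1))) (hk : k ∉ C) (hzk : ReachOff A C z k)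
    (hp : π k ≠ x q) :
    m + 1 ≤ #{l ∈ range m | A (x l) (x q)} + #{l ∈ range m | Leaves A C z (x l)} := by
  obtain ⟨u, hu, h, huz⟩ := h
  have ho := H.ore k (x q) (by rintro rfl; exact hk (L.apply_mem q))
    (fun hA => L.not_bridge q hu (huz.trans hzk) h hA) hp
  rw [L.card_filter_univ, L.card_filter_univ] at ho
  have h1 : #{l ∈ range m | A k (x l)} ≤ #{l ∈ range m | Leaves A C z (x l)} :=
    card_le_card (monotone_filter_right _ fun l _ hl => ⟨k, hk, hzk, hl⟩)
  have h2 : #({v ∈ Cᶜ | A k v} ∪ {v ∈ Cᶜ | A v (x q)}) ≤ #(Cᶜ.erase k) := by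
    refine card_le_card fun w hw => ?_
    simp only [mem_union, mem_filter, mem_erase] at hw ⊢
    refine ⟨?_, by tauto⟩
    rintro rfl
    rcases hw with hw | hw
    · exact H.irrefl _ hw.2
    · exact L.not_bridge q hu (huz.trans hzk) h hw.2
  rw [card_union_of_disjoint, card_erase_of_mem (mem_compl.2 hk)] at h2
  · have := card_compl_add_card C
    have := L.card_eq
    have : 0 < #Cᶜ := card_pos.2 ⟨k, mem_compl.2 hk⟩
    omega
  · rw [disjoint_left]
    intro w hw hw'
    simp only [mem_filter, mem_compl] at hw hw'
    exact L.not_bridge q hu ((huz.trans hzk).tail ⟨hw.2, hk, hw.1⟩) h hw'.2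

theorem card_from_last (L : IsLongestCycle A C m x) (H : IsOreOff A π) {i : ℕ} {k : V}
    (h : Leaves A C z (x (i + 1))) (hk : k ∉ C) (hkz : ReachOff A C k z)
    (hp : π (x i) ≠ k) :
    m + 1 ≤ #{l ∈ range m | A (x i) (x l)} + #{l ∈ range m | Enters A C z (x l)} := by
  obtain ⟨v, hv, hzv, h⟩ := h
  have hi : x i = x (i + 1 + m - 1) := by
    rw [show i + 1 + m - 1 = i + m by omega, L.periodic]
  have hnot : ∀ u ∉ C, ReachOff A C u k → ¬A (x i) u := fun u hu huk hA =>
    L.not_bridge (i + 1) hu (huk.trans (hkz.trans hzv)) (hi ▸ hA) h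
  have ho := H.ore (x i) k (by rintro rfl; exact hk (L.apply_mem i)) (hnot k hk .refl) hp
  rw [L.card_filter_univ, L.card_filter_univ] at ho
  have h1 : #{l ∈ range m | A (x l) k} ≤ #{l ∈ range m | Enters A C z (x l)} :=
    card_le_card (monotone_filter_right _ fun l _ hl => ⟨k, hk, hl, hkz⟩)
  have h2 : #({v ∈ Cᶜ | A (x i) v} ∪ {v ∈ Cᶜ | A v k}) ≤ #(Cᶜ.erase k) := by
    refine card_le_card fun w hw => ?_
    simp only [mem_union, mem_filter, mem_erase] at hw ⊢
    refine ⟨?_, by tauto⟩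
    rintro rfl
    rcases hw with hw | hw
    · exact hnot _ hk .refl hw.2
    · exact H.irrefl _ hw.2
  rw [card_union_of_disjoint, card_erase_of_mem (mem_compl.2 hk)] at h2
  · have := card_compl_add_card C
    have := L.card_eq
    have : 0 < #Cᶜ := card_pos.2 ⟨k, mem_compl.2 hk⟩
    omega
  · rw [disjoint_left]
    intro w hw hw'
    simp only [mem_filter, mem_compl] at hw hw'
    exact hnot w hw.1 (.single ⟨hw'.2, hw.1, hk⟩) hw.2

theorem two_le (L : IsLongestCycle A C m x) (H : IsOreOff A π) : 2 ≤ m := by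
  by_contra h
  have h1 : m = 1 := by have := L.pos; omega
  subst h1
  have := L.adj 0
  rw [L.periodic] at this
  exact H.irrefl _ this

theorem exists_enters (L : IsLongestCycle A C m x) (H : IsOreOff A π) (hz : z ∉ C) :
    ∃ k, Enters A C z (x k) ∧ π z ≠ x (k + 1) := by
  set T : Finset V := {v | v ∉ C ∧ ReachOff A C v z} with hT
  have hCT : C ⊆ Tᶜ := by
    intro v hv
    simp [hT, hv]
  have h2 := H.two_le_card_entering (T := T) ⟨z, by simp [hT, hz]; exact .refl⟩
    ((L.card_eq ▸ L.two_le H : 2 ≤ #C).trans (card_le_card hCT))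
  obtain ⟨a, ha, b, hb, hab⟩ := one_lt_card.1 h2
  have key : ∀ a ∈ {u ∈ Tᶜ | ∃ t ∈ T, A u t}, ∃ k, x k = a ∧ Enters A C z a := by
    intro a ha
    simp only [hT, mem_filter, mem_compl, mem_univ, true_and, not_and] at ha
    obtain ⟨ha, t, ⟨ht, htz⟩, hat⟩ := ha
    have haC : a ∈ C := by
      by_contra h
      exact ha h (.head ⟨hat, h, ht⟩ htz)
    obtain ⟨k, hk⟩ := (L.mem a).1 haC
    exact ⟨k, hk, t, ht, hat, htz⟩
  obtain ⟨j, rfl, hj⟩ := key a ha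
  obtain ⟨k, rfl, hk⟩ := key b hb
  -- Only one vertex of the cycle has `π z` as its successor, so two entering vertices cannot both
  -- be blocked.
  by_contra hcon
  push Not at hcon
  have e := (hcon j hj).symm.trans (hcon k hk)
  have := L.shift 1
  have h3 := (this.apply_mod j).trans (e.trans (this.apply_mod k).symm)
  have h4 := this.inj _ (Nat.mod_lt _ L.pos) _ (Nat.mod_lt _ L.pos) h3
  exact hab (by rw [← L.apply_mod j, ← L.apply_mod k, h4])

theorem exists_leaves (L : IsLongestCycle A C m x) (H : IsOreOff A π) (hz : z ∉ C) :
    ∃ k < m, Leaves A C z (x (k + 1)) ∧ π (x k) ≠ z := by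
  set T : Finset V := {v | v ∉ C ∧ ReachOff A C z v} with hT
  have hCT : C ⊆ Tᶜ := by
    intro v hv
    simp [hT, hv]
  have h2 := H.two_le_card_leaving (T := T) ⟨z, by simp [hT, hz]; exact .refl⟩
    ((L.card_eq ▸ L.two_le H : 2 ≤ #C).trans (card_le_card hCT))
  obtain ⟨a, ha, b, hb, hab⟩ := one_lt_card.1 h2
  have key : ∀ a ∈ {u ∈ Tᶜ | ∃ t ∈ T, A t u}, ∃ k < m, x (k + 1) = a ∧ Leaves A C z a := by
    intro a ha
    simp only [hT, mem_filter, mem_compl, mem_univ, true_and, not_and] at ha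
    obtain ⟨ha, t, ⟨ht, htz⟩, hat⟩ := ha
    have haC : a ∈ C := by
      by_contra h
      exact ha h (htz.tail ⟨hat, ht, h⟩)
    obtain ⟨k, hk⟩ := ((L.shift 1).mem a).1 haC
    obtain ⟨t', ht', e⟩ := (L.shift 1).exists_lt k
    exact ⟨t', ht', e.trans hk, t, ht, htz, hat⟩
  obtain ⟨j, hjm, rfl, hj⟩ := key a ha
  obtain ⟨k, hkm, rfl, hk⟩ := key b hb
  by_contra hcon
  push Not at hcon
  have e := π.injective ((hcon j hjm hj).trans (hcon k hkm hk).symm)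
  exact hab (by rw [L.inj j hjm k hkm e])

/-- The position of a vertex `z` off a longest cycle, relative to which no exchange helps: between
an entering vertex `x (i + g + 1)` and a vertex `x i` whose successor is reached from `z` lie only
two attachments, and these are blocked by `π`. -/
structure IsTight (A : V → V → Prop) (π : Equiv.Perm V) (C : Finset V) (z : V) (x : ℕ → V)
    (i g : ℕ) : Prop where
  enters_last : Enters A C z (x (i + g + 1))
  leaves_succ : Leaves A C z (x (i + 1))
  enters : ∃ p < i, Enters A C z (x p) ∧ ∀ k ∉ C, ReachOff A C z k → π k = x (p + 1)
  leaves : ∃ p < i, Leaves A C z (x (p + 1)) ∧ ∀ k ∉ C, ReachOff A C k z → π (x p) = k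
  enters_eq : ∀ j < i, Enters A C z (x j) → π z = x (j + 1)
  leaves_eq : ∀ j < i, Leaves A C z (x (j + 1)) → π (x j) = z
  into : ∀ j < i, A (x (1 + j)) (x 0)
  from_lt : ∀ j < i, A (x i) (x j)
  from_succ : A (x i) (x (i + 1))
  into_or_from : ∀ j < g, A (x (i + 1 + j)) (x 0) ∨ A (x i) (x (i + 2 + j))
  enters_or_leaves : ∀ j < g + 1, Enters A C z (x (i + j)) ∨ Leaves A C z (x (i + 1 + j))

theorem count (L : IsLongestCycle A C m x) (H : IsOreOff A π) {i g : ℕ} (hm : m = i + g + 2)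
    (h₁ : Enters A C z (x (i + g + 1))) (h₁' : ∃ k ∉ C, ReachOff A C z k ∧ π k ≠ x 0)
    (h₂ : Leaves A C z (x (i + 1))) (h₂' : ∃ k ∉ C, ReachOff A C k z ∧ π (x i) ≠ k)
    (ha : ∀ j < i, ∀ k < i, Enters A C z (x j) → Enters A C z (x k) → j = k)
    (hb : ∀ j < i, ∀ k < i, Leaves A C z (x (1 + j)) → Leaves A C z (x (1 + k)) → j = k) :
    (∃ p < i, Enters A C z (x p)) ∧ (∃ p < i, Leaves A C z (x (1 + p))) ∧
      (∀ j < i, A (x (1 + j)) (x 0)) ∧ (∀ j < i, A (x i) (x j)) ∧ A (x i) (x (i + 1)) ∧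
      (∀ j < g, A (x (i + 1 + j)) (x 0) ∨ A (x i) (x (i + 2 + j))) ∧
      (∀ j < g + 1, Enters A C z (x (i + j)) ∨ Leaves A C z (x (i + 1 + j))) := by
  obtain ⟨k, hk, hzk, hp⟩ := h₁'
  obtain ⟨k', hk', hkz, hp'⟩ := h₂'
  have e : 0 + m - 1 = i + g + 1 := by omega
  have hw := L.card_into_first H (q := 0) (by rwa [e]) hk hzk hp
  have ho := L.card_from_last H h₂ hk' hkz hp'
  subst hm
  refine exchange_count (w := fun l => A (x l) (x 0)) (o := fun l => A (x i) (x l))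
    (a := fun l => Enters A C z (x l)) (b := fun l => Leaves A C z (x l))
    (H.irrefl _) (H.irrefl _) ?_ ?_ ?_ hw ho ha hb
  · rintro j hj ⟨hw, ho⟩
    refine L.not_exchange (q := 0) (i := i) (l := i + 1 + j) (by omega) (by omega) (by omega)
      (by rwa [e]) h₂ hw ?_
    rwa [show i + 1 + j + 1 = i + 2 + j by omega]
  · rintro j - ⟨h, h'⟩
    exact L.not_enters_leaves h (by rwa [show i + j + 1 = i + 1 + j by omega])
  · intro h
    refine L.not_enters_leaves h₁ ?_
    rwa [show i + g + 1 + 1 = 0 + (i + g + 2) by omega, L.periodic]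

/-- Take an unblocked way out and an unblocked way back with the fewest vertices skipped (`i`
minimal). Any attachment inside the skipped stretch would give a smaller `i` unless `π` blocks it,
and `π` can block only one in each direction. This is what `count` needs. -/
theorem exists_isTight (L : IsLongestCycle A C m x) (H : IsOreOff A π) (hz : z ∉ C) :
    ∃ y i g, m = i + g + 2 ∧ IsLongestCycle A C m y ∧ IsTight A π C z y i g := by
  have hex : ∃ i, i < m ∧ ∃ y, IsLongestCycle A C m y ∧ (Enters A C z (y (m - 1)) ∧
      ∃ k ∉ C, ReachOff A C z k ∧ π k ≠ y 0) ∧ Leaves A C z (y (i + 1)) ∧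
      ∃ k ∉ C, ReachOff A C k z ∧ π (y i) ≠ k := by
    obtain ⟨k, hk, hp⟩ := L.exists_enters H hz
    obtain ⟨i, hi, h, hp'⟩ := (L.shift (k + 1)).exists_leaves H hz
    have hm := L.pos
    refine ⟨i, hi, _, L.shift (k + 1), ⟨?_, z, hz, .refl, ?_⟩, h, z, hz, .refl, hp'⟩
    · rwa [show m - 1 + (k + 1) = k + m by omega, L.periodic]
    · rwa [zero_add]
  obtain ⟨hi, y, hy, ⟨h₁, h₁'⟩, h₂, h₂'⟩ := Nat.find_spec hex
  have hmin := fun j => Nat.find_min hex (m := j)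
  set i := Nat.find hex
  have him : i ≠ m - 1 := by
    intro e
    rw [← e] at h₁
    exact hy.not_enters_leaves h₁ h₂
  obtain ⟨g, hg⟩ : ∃ g, m = i + g + 2 := ⟨m - 2 - i, by omega⟩
  have hbadA : ∀ j < i, Enters A C z (y j) → ∀ k ∉ C, ReachOff A C z k → π k = y (j + 1) := by
    intro j hj hE k hk hzk
    by_contra hp
    -- Leaving the cycle at `y j` instead, so that the skipped stretch starts at `y (j + 1)`.
    refine hmin (i - (j + 1)) (by omega) ⟨by omega, _, hy.shift (j + 1), ⟨?_, k, hk, hzk, ?_⟩, ?_⟩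
    · rwa [show m - 1 + (j + 1) = j + m by omega, hy.periodic]
    · rwa [zero_add]
    · rw [show i - (j + 1) + 1 + (j + 1) = i + 1 by omega,
        show i - (j + 1) + (j + 1) = i by omega]
      exact ⟨h₂, h₂'⟩
  have hbadB : ∀ j < i, Leaves A C z (y (j + 1)) → ∀ k ∉ C, ReachOff A C k z → π (y j) = k := by
    intro j hj hE k hk hzk
    by_contra hp
    exact hmin j hj ⟨by omega, y, hy, ⟨h₁, h₁'⟩, hE, k, hk, hzk, hp⟩
  have e : m - 1 = i + g + 1 := by omega
  rw [e] at h₁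
  obtain ⟨⟨p, hp, hpE⟩, ⟨p', hp', hpL⟩, c1, c2, c3, c4, c5⟩ :=
    hy.count H hg h₁ h₁' h₂ h₂' (fun j hj k hk hEj hEk => by
      have := (hbadA j hj hEj z hz .refl).symm.trans (hbadA k hk hEk z hz .refl)
      have := hy.inj _ (by omega) _ (by omega) this
      omega) (fun j hj k hk hLj hLk => by
      rw [add_comm] at hLj hLk
      exact hy.inj _ (by omega) _ (by omega) (π.injective
        ((hbadB j hj hLj z hz .refl).trans (hbadB k hk hLk z hz .refl).symm)))
  rw [add_comm] at hpL
  exact ⟨y, i, g, hg, hy, h₁, h₂, ⟨p, hp, hpE, hbadA p hp hpE⟩, ⟨p', hp', hpL, hbadB p' hp' hpL⟩,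
    fun j hj h => hbadA j hj h z hz .refl, fun j hj h => hbadB j hj h z hz .refl, c1, c2, c3, c4, c5⟩

/-- The blocked attachments of a tight position constrain all vertices connected to `z` off `C` at
once: each has the same image, or the same preimage, under `π` as `z`. -/
theorem eq_of_reachOff (L : IsLongestCycle A C m x) (H : IsOreOff A π) (hz : z ∉ C) {v : V}
    (hv : v ∉ C) (h : ReachOff A C z v ∨ ReachOff A C v z) : v = z := by
  obtain ⟨y, i, g, -, -, T⟩ := L.exists_isTight H hz
  obtain ⟨p, -, -, hp⟩ := T.enters
  obtain ⟨p', -, -, hp'⟩ := T.leaves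
  rcases h with h | h
  · exact π.injective ((hp v hv h).trans (hp z hz .refl).symm)
  · exact (hp' v hv h).symm.trans (hp' z hz .refl)

theorem perm_apply_mem (L : IsLongestCycle A C m x) (H : IsOreOff A π) (hz : z ∉ C) :
    π z ∈ C := by
  obtain ⟨y, i, g, -, hy, T⟩ := L.exists_isTight H hz
  obtain ⟨p, -, -, hp⟩ := T.enters
  rw [hp z hz .refl]
  exact hy.apply_mem _

theorem enters_iff (L : IsLongestCycle A C m x) (H : IsOreOff A π) (hz : z ∉ C) {a : V} :
    Enters A C z a ↔ A a z := by
  constructor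
  · rintro ⟨v, hv, h, hvz⟩
    rwa [L.eq_of_reachOff H hz hv (Or.inr hvz)] at h
  · exact fun h => ⟨z, hz, h, .refl⟩

theorem leaves_iff (L : IsLongestCycle A C m x) (H : IsOreOff A π) (hz : z ∉ C) {b : V} :
    Leaves A C z b ↔ A z b := by
  constructor
  · rintro ⟨v, hv, hvz, h⟩
    rwa [L.eq_of_reachOff H hz hv (Or.inl hvz)] at h
  · exact fun h => ⟨z, hz, .refl, h⟩

/-- All neighbours of `z` lie on the cycle, and `x k → z` excludes `z → x (k + 1)`. -/
theorem card_add_card_le (L : IsLongestCycle A C m x) (H : IsOreOff A π) (hz : z ∉ C) :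
    #{w | A z w} + #{w | A w z} ≤ m := by
  have h0 : ∀ P : V → Prop, (∀ v ∉ C, ¬P v) → #{v | P v} = #{k ∈ range m | P (x k)} := by
    intro P hP
    rw [L.card_filter_univ, filter_false_of_mem (s := Cᶜ), card_empty, add_zero]
    exact fun v hv => hP v (mem_compl.1 hv)
  have hirr : ∀ v ∉ C, A z v ∨ A v z → False := by
    intro v hv h
    have : v = z := by
      refine L.eq_of_reachOff H hz hv (h.imp ?_ ?_)
      · exact fun h => .single ⟨h, hz, hv⟩
      · exact fun h => .single ⟨h, hv, hz⟩
    subst this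
    exact H.irrefl v (h.elim id id)
  rw [h0 _ fun v hv h => hirr v hv (Or.inl h), h0 _ fun v hv h => hirr v hv (Or.inr h)]
  have hs : #{k ∈ range m | A z (x k)} = #{k ∈ range m | A z (x (k + 1))} := by
    rw [← L.card_filter (A z), ← (L.shift 1).card_filter (A z)]
  rw [hs, ← card_union_of_disjoint]
  · exact (card_le_card (union_subset (filter_subset _ _) (filter_subset _ _))).trans (by simp)
  · rw [disjoint_left]
    intro k hk hk'
    rw [mem_filter] at hk hk'
    exact L.not_enters_leaves ((L.enters_iff H hz).2 hk'.2) ((L.leaves_iff H hz).2 hk.2)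

/-- Two vertices off `C` are non-adjacent and not exceptional in either direction, as `π` sends both
into `C`. Ore's condition both ways bounds their total degrees below by `2n`, while they are at most
`2m < 2n`. -/
theorem eq_of_not_mem (L : IsLongestCycle A C m x) (H : IsOreOff A π) (hz : z ∉ C) {v : V}
    (hv : v ∉ C) : v = z := by
  by_contra hne
  have hno : ∀ {u v}, u ∉ C → v ∉ C → u ≠ v → ¬A u v := fun hu hv huv h =>
    huv (L.eq_of_reachOff H hv hu (Or.inr (.single ⟨h, hu, hv⟩)))
  have h1 := H.ore v z hne (hno hv hz hne) fun e => hz (e ▸ L.perm_apply_mem H hv)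
  have h2 := H.ore z v (Ne.symm hne) (hno hz hv (Ne.symm hne))
    fun e => hv (e ▸ L.perm_apply_mem H hz)
  have h3 := L.card_add_card_le H hz
  have h4 := L.card_add_card_le H hv
  have h5 := L.card_eq
  have h6 : #C < Fintype.card V := card_lt_univ_of_notMem hz
  omega

theorem eq_compl (L : IsLongestCycle A C m x) (H : IsOreOff A π) (hz : z ∉ C) : C = {z}ᶜ := by
  ext v
  rw [mem_compl, mem_singleton]
  exact ⟨by rintro h rfl; exact hz h, fun h => by_contra fun hv => h (L.eq_of_not_mem H hz hv)⟩

end IsLongestCycle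

theorem card_out_add_card_le {u : V} {F : Finset V} (h : ∀ w ∈ F, ¬A u w) :
    #{w | A u w} + #F ≤ Fintype.card V := by
  rw [← card_union_of_disjoint]
  · exact card_le_univ _
  · rw [disjoint_left]
    intro w hw hF
    exact h w hF (by simpa using hw)

theorem card_in_add_card_le {v : V} {F : Finset V} (h : ∀ w ∈ F, ¬A w v) :
    #{w | A w v} + #F ≤ Fintype.card V :=
  card_out_add_card_le (A := fun a b => A b a) h

/-! ### Trading the missed vertex for one of larger degree -/

namespace IsLongestCycle

variable {C : Finset V} {m : ℕ} {x : ℕ → V} {z : V}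

theorem card_in_eq (L : IsLongestCycle A C m x) (H : IsOreOff A π) (hz : z ∉ C) :
    #{w | A w z} = #{k ∈ range m | A (x k) z} := by
  rw [L.card_filter_univ, add_eq_left, card_eq_zero, filter_eq_empty_iff]
  intro v hv h
  rw [L.eq_of_not_mem H hz (mem_compl.1 hv)] at h
  exact H.irrefl _ h

theorem card_out_eq (L : IsLongestCycle A C m x) (H : IsOreOff A π) (hz : z ∉ C) :
    #{w | A z w} = #{k ∈ range m | A z (x (k + 1))} := by
  rw [(L.shift 1).card_filter_univ, add_eq_left, card_eq_zero, filter_eq_empty_iff]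
  intro v hv h
  rw [L.eq_of_not_mem H hz (mem_compl.1 hv)] at h
  exact H.irrefl _ h

/-- Beyond `x i`, the arcs from `z` come before the arcs into `z`. At the switch from one kind to
the other sits a vertex `v` that can be exchanged for `z`, and Ore's condition at the two blocked
attachments makes both degrees of `v` large. -/
theorem IsTight.exists_larger {i g : ℕ} (T : IsTight A π C z x i g) (L : IsLongestCycle A C m x)
    (H : IsOreOff A π) (hz : z ∉ C) (hm : m = i + g + 2) :
    ∃ v y, IsCyclicWalk A m y ∧ (∀ k, y k ≠ v) ∧
      #{w | A z w} + #{w | A w z} < #{w | A v w} + #{w | A w v} := by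
  have hE : ∀ {a}, Enters A C z a ↔ A a z := L.enters_iff H hz
  have hL : ∀ {b}, Leaves A C z b ↔ A z b := L.leaves_iff H hz
  have hxz : ∀ k, x k ≠ z := by
    rintro k rfl
    exact hz (L.apply_mem k)
  have hx0 : x m = x 0 := by rw [← L.periodic 0, zero_add]
  have hel : ∀ k, A (x k) z → A z (x (k + 1)) → False := fun k h h' =>
    L.not_enters_leaves (hE.2 h) (hL.2 h')
  obtain ⟨p, hp, hpE, hpπ⟩ := T.enters
  obtain ⟨q, hq, hqL, hqπ⟩ := T.leaves
  replace hpπ := hpπ z hz .refl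
  replace hqπ := hqπ z hz .refl
  rw [hE] at hpE
  rw [hL] at hqL
  have hlast : A (x (m - 1)) z := by
    rw [show m - 1 = i + g + 1 by omega]
    exact hE.1 T.enters_last
  have hsucc : A z (x (i + 1)) := hL.1 T.leaves_succ
  have hxch : ∀ {j l}, j < l → l + 1 < m → A z (x (j + 1)) → A (x l) (x 0) →
      A (x j) (x (l + 1)) → False := by
    intro j l hjl hl h h₁ h₂
    exact L.not_exchange (q := 0) (Nat.zero_le j) hjl (by omega)
      (by rw [zero_add]; exact hE.2 hlast) (hL.2 h) h₁ h₂
  have hπz : ∀ k < m, k ≠ q → π (x k) ≠ z := by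
    intro k hk hkq h
    exact hkq (L.inj _ hk _ (by omega) (π.injective (h.trans hqπ.symm)))
  have hzπ : ∀ k < m, k ≠ p + 1 → π z ≠ x k := by
    intro k hk hkp h
    exact hkp (L.inj _ hk _ (by omega) (h.symm.trans hpπ))
  -- the attachments of `z` other than the two blocked ones
  set I : Finset ℕ := {k ∈ range m | A (x k) z}.erase p with hI
  set O : Finset ℕ := {k ∈ range m | A z (x (k + 1))}.erase q with hO
  have hIcard : #I + 1 = #{w | A w z} := by
    rw [L.card_in_eq H hz, hI]
    exact card_erase_add_one (mem_filter.2 ⟨mem_range.2 (by omega), hpE⟩)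
  have hOcard : #O + 1 = #{w | A z w} := by
    rw [L.card_out_eq H hz, hO]
    exact card_erase_add_one (mem_filter.2 ⟨mem_range.2 (by omega), hqL⟩)
  have hImem : ∀ k, k ∈ I ↔ k ≠ p ∧ k < m ∧ A (x k) z := by
    intro k
    rw [hI, mem_erase, mem_filter, mem_range]
  have hOmem : ∀ k, k ∈ O ↔ k ≠ q ∧ k < m ∧ A z (x (k + 1)) := by
    intro k
    rw [hO, mem_erase, mem_filter, mem_range]
  have hIlt : ∀ k ∈ I, i < k ∧ k < m ∧ A (x k) z := by
    intro k hk
    rw [hImem] at hk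
    refine ⟨?_, hk.2⟩
    by_contra hki
    rcases Nat.lt_or_ge k i with h | h
    · have := T.enters_eq k h (hE.2 hk.2.2)
      exact hzπ (k + 1) (by omega) (by omega) this
    · obtain rfl : k = i := by omega
      exact hel _ hk.2.2 hsucc
  have hOlt : ∀ k ∈ O, i ≤ k ∧ k + 1 < m ∧ A z (x (k + 1)) := by
    intro k hk
    rw [hOmem] at hk
    refine ⟨?_, ?_, hk.2.2⟩
    · by_contra hki
      exact hπz k hk.2.1 hk.1 (T.leaves_eq k (by omega) (hL.2 hk.2.2))
    · by_contra hkm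
      refine hel k ?_ hk.2.2
      rwa [show k = m - 1 by omega]
  have hmono : ∀ d k, i ≤ k → k + d < m → A (x k) z → A (x (k + d)) z := by
    intro d
    induction d with
    | zero => exact fun k _ _ h => h
    | succ d ih =>
      intro k hk hkd h
      have h' := ih k hk (by omega) h
      rcases Nat.lt_or_ge (k + (d + 1)) (m - 1) with hlt | hge
      · rcases T.enters_or_leaves (k + (d + 1) - i) (by omega) with h₁ | h₁
        · rw [hE, show i + (k + (d + 1) - i) = k + (d + 1) by omega] at h₁
          exact h₁
        · exfalso
          rw [hL, show i + 1 + (k + (d + 1) - i) = k + d + 2 by omega] at h₁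
          -- Here only `x (k + d + 1)` would be skipped. Equality in the count demands an attachment
          -- at a position below `i = 0`, which does not exist.
          have := (L.shift (k + d + 1)).count (z := z) H (i := 0) (g := m - 2) (by omega)
            (by
              rw [show 0 + (m - 2) + 1 + (k + d + 1) = k + d + m by omega, L.periodic]
              exact hE.2 h')
            ⟨z, hz, .refl, by rw [zero_add]; exact hzπ _ (by omega) (by omega)⟩
            (by rw [show 0 + 1 + (k + d + 1) = k + d + 2 by omega]; exact hL.2 h₁)
            ⟨z, hz, .refl, by rw [zero_add]; exact hπz _ (by omega) (by omega)⟩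
            (by omega) (by omega)
          obtain ⟨_, h0, _⟩ := this.1
          omega
      · rw [show k + (d + 1) = m - 1 by omega]
        exact hlast
  have hOI : ∀ j ∈ O, ∀ k, i ≤ k → k < m → A (x k) z → j < k := by
    intro j hj k hik hk h
    by_contra hjk
    have := hOlt j hj
    refine hel j ?_ this.2.2
    have := hmono (j - k) k hik (by omega) h
    rwa [show k + (j - k) = j by omega] at this
  have hinto : ∀ j < g, A z (x (i + 2 + j)) → A (x (i + 1 + j)) (x 0) := by
    intro j hj h
    by_contra hW
    have hF := (T.into_or_from j hj).resolve_left hW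
    have hjO : i + 1 + j ∈ O :=
      (hOmem _).2 ⟨by omega, by omega, by rwa [show i + 1 + j + 1 = i + 2 + j by omega]⟩
    have hnz : ¬A (x (i + 1 + j)) z := fun h' =>
      hel _ h' (by rwa [show i + 1 + j + 1 = i + 2 + j by omega])
    -- An exchange starting at `x (k + 1)` forbids these arcs. They are `#I` in number and `z` has
    -- in-degree `#I + 1`, which contradicts Ore's condition for `x (i + 1 + j)` and `z`.
    have hmiss : ∀ k ∈ I, ¬A (x (i + 1 + j)) (x (k + 1)) := by
      intro k hk hA
      obtain ⟨h1, h2, h3⟩ := hIlt k hk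
      have hlt := hOI _ hjO k (by omega) h2 h3
      refine L.not_exchange (z := z) (q := k + 1) (i := i + m) (l := i + 1 + j + m) (by omega)
        (by omega) (by omega) ?_ ?_ ?_ ?_
      · rw [show k + 1 + m - 1 = k + m by omega, L.periodic]
        exact hE.2 h3
      · rw [show i + m + 1 = i + 1 + m by omega, L.periodic]
        exact T.leaves_succ
      · rwa [L.periodic]
      · rwa [L.periodic, show i + 1 + j + m + 1 = i + 2 + j + m by omega, L.periodic]
    have h1 := H.ore _ _ (hxz _) hnz (hπz _ (by omega) (by omega))
    have h2 := card_out_add_card_le (A := A) (u := x (i + 1 + j))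
      (F := insert (x (i + 1 + j)) (insert z (I.image fun k => x (k + 1)))) (by
        simp only [mem_insert, mem_image]
        rintro w (rfl | rfl | ⟨k, hk, rfl⟩)
        · exact H.irrefl _
        · exact hnz
        · exact hmiss k hk)
    rw [card_insert_of_notMem, card_insert_of_notMem, card_image_of_injOn] at h2
    · omega
    · intro a ha b hb e
      exact (L.shift 1).inj a (hIlt a ha).2.1 b (hIlt b hb).2.1 e
    · simp only [mem_image, not_exists, not_and]
      exact fun k _ => hxz _
    · simp only [mem_insert, mem_image, not_or, not_exists, not_and]
      refine ⟨hxz _, fun k hk e => ?_⟩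
      obtain ⟨h3, h4, h5⟩ := hIlt k hk
      have hlt := hOI _ hjO k (by omega) h4 h5
      have := L.inj_window (q := 1) (by omega) (by omega) (by omega) (by omega) e
      omega
  have hfrom : ∀ j < g, A (x (i + 1 + j)) z → A (x i) (x (i + 2 + j)) := by
    intro j hj h
    by_contra hF
    have hW := (T.into_or_from j hj).resolve_right hF
    have hnz : ¬A z (x (i + 2 + j)) := fun h' =>
      hel _ h (by rwa [show i + 1 + j + 1 = i + 2 + j by omega])
    have hmiss : ∀ k ∈ O, ¬A (x k) (x (i + 2 + j)) := by
      intro k hk hA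
      have hlt := hOI k hk _ (by omega) (by omega) h
      exact hxch hlt (by omega) (hOlt k hk).2.2 hW
        (by rwa [show i + 1 + j + 1 = i + 2 + j by omega])
    have h1 := H.ore _ _ (hxz _).symm hnz (hzπ _ (by omega) (by omega))
    have h2 := card_in_add_card_le (A := A) (v := x (i + 2 + j))
      (F := insert (x (i + 2 + j)) (insert z (O.image x))) (by
        simp only [mem_insert, mem_image]
        rintro w (rfl | rfl | ⟨k, hk, rfl⟩)
        · exact H.irrefl _
        · exact hnz
        · exact hmiss k hk)
    rw [card_insert_of_notMem, card_insert_of_notMem, card_image_of_injOn] at h2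
    · omega
    · intro a ha b hb e
      have := hOlt a ha
      have := hOlt b hb
      exact L.inj a (by omega) b (by omega) e
    · simp only [mem_image, not_exists, not_and]
      exact fun k _ => hxz _
    · simp only [mem_insert, mem_image, not_or, not_exists, not_and]
      refine ⟨hxz _, fun k hk e => ?_⟩
      have hlt := hOI k hk _ (by omega) (by omega) h
      have := L.inj _ (by omega) _ (by omega) e
      omega
  -- a vertex between `x i` and the last one that is joined to `x 0`
  obtain ⟨j₁, hj₁, hW₁⟩ : ∃ j < g, A (x (i + 1 + j)) (x 0) := by
    have hne : π (x i) ≠ z := hπz i (by omega) (by omega)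
    have hC : π (x i) ∈ C := by
      rw [L.eq_compl H hz]
      simpa using hne
    rw [L.eq_image, mem_image] at hC
    obtain ⟨t, ht, hte⟩ := hC
    rw [mem_range] at ht
    have hnA : ¬A (x i) (x t) := hte ▸ H.not_adj _
    have h1 : ¬t < i := fun h => hnA (T.from_lt t h)
    have h2 : t ≠ i := by rintro rfl; exact H.ne _ hte.symm
    have h3 : t ≠ i + 1 := by rintro rfl; exact hnA T.from_succ
    refine ⟨t - (i + 2), by omega, (T.into_or_from _ (by omega)).resolve_right ?_⟩
    rwa [show i + 2 + (t - (i + 2)) = t by omega]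
  -- Witnessed by the preimage of `x 0` under `π`. The vertex at `j₁` has no arc to `z` and the one
  -- at `j₂` has one, so a switch occurs.
  obtain ⟨j₂, hj₂, hW₂⟩ : ∃ j < g, ¬A (x (i + 1 + j)) (x 0) := by
    have hne : π⁻¹ (x 0) ≠ z := by
      intro h
      exact hzπ 0 (by omega) (by omega) (by rw [← h]; simp)
    have hC : π⁻¹ (x 0) ∈ C := by
      rw [L.eq_compl H hz]
      simpa using hne
    rw [L.eq_image, mem_image] at hC
    obtain ⟨t, ht, hte⟩ := hC
    rw [mem_range] at ht
    have hte' : π (x t) = x 0 := by rw [hte]; simp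
    have hnA : ¬A (x t) (x 0) := hte' ▸ H.not_adj _
    have h1 : t ≠ 0 := by rintro rfl; exact H.ne _ hte'
    have h2 : ¬t ≤ i := fun h => hnA (by
      have := T.into (t - 1) (by omega)
      rwa [show 1 + (t - 1) = t by omega] at this)
    have h3 : t ≠ m - 1 := by
      rintro rfl
      have := L.adj (m - 1)
      rw [Nat.sub_add_cancel L.pos, hx0] at this
      exact hnA this
    refine ⟨t - (i + 1), by omega, ?_⟩
    rwa [show i + 1 + (t - (i + 1)) = t by omega]
  have hdich : ∀ j < g, A (x (i + 1 + j)) z ∨ A z (x (i + 2 + j)) := by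
    intro j hj
    have := T.enters_or_leaves (j + 1) (by omega)
    rwa [hE, hL, show i + (j + 1) = i + 1 + j by omega,
      show i + 1 + (j + 1) = i + 2 + j by omega] at this
  have hj₁' : ¬A (x (i + 1 + j₁)) z := by
    intro h
    refine hxch (j := i) (l := i + 1 + j₁) (by omega) (by omega) hsucc hW₁ ?_
    rw [show i + 1 + j₁ + 1 = i + 2 + j₁ by omega]
    exact hfrom j₁ hj₁ h
  have hj₂' : A (x (i + 1 + j₂)) z := (hdich j₂ hj₂).resolve_right fun h => hW₂ (hinto j₂ hj₂ h)
  have hex : ∃ j, A (x (i + 1 + j)) z := ⟨j₂, hj₂'⟩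
  obtain ⟨j, hjg, hjE, hjn⟩ : ∃ j, j + 1 < g ∧ A (x (i + 1 + (j + 1))) z ∧
      ¬A (x (i + 1 + j)) z := by
    have h1 := Nat.find_min' hex hj₂'
    have h2 := Nat.find_spec hex
    have h3 : j₁ < Nat.find hex := by
      by_contra h
      have := hmono (j₁ - Nat.find hex) _ (by omega) (by omega) h2
      rw [show i + 1 + Nat.find hex + (j₁ - Nat.find hex) = i + 1 + j₁ by omega] at this
      exact hj₁' this
    refine ⟨Nat.find hex - 1, by omega, ?_, Nat.find_min hex (by omega)⟩
    rwa [Nat.sub_add_cancel (by omega)]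
  have hjL : A z (x (i + 2 + j)) := (hdich j (by omega)).resolve_left hjn
  have hW := hinto j (by omega) hjL
  have hF := hfrom (j + 1) (by omega) hjE
  refine ⟨x (i + 2 + j), ?_⟩
  -- As `l' = l + 2`, exactly `x (i + 2 + j)` is dropped while `z` is added, so the length stays
  -- `m`.
  obtain ⟨y, hy, hyx⟩ := L.exchange (q := 0) (i := i) (l := i + 1 + j) (l' := i + 2 + (j + 1))
    (by omega) (by omega) (by omega) (by omega) (IsWalk.singleton z) (by simp)
    (fun k hk => hxz k (by simpa using hk)) (by rw [zero_add]; exact hlast) hsucc hW hF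
  refine ⟨y, ?_, ?_, ?_⟩
  · convert hy using 1
    rw [List.length_singleton]
    omega
  · intro k e
    rcases hyx k with h | ⟨t, -, h1, h2, h3⟩
    · rw [List.mem_singleton, e] at h
      exact hxz _ h
    · have := L.inj _ (by omega) _ (by omega) (h3.trans e)
      omega
  · have hOW : ∀ k ∈ O, A (x k) (x 0) := by
      intro k hk
      obtain ⟨h1, h2, h3⟩ := hOlt k hk
      rcases h1.eq_or_lt with rfl | h1
      · have := T.into (i - 1) (by omega)
        rwa [show 1 + (i - 1) = i by omega] at this
      · have := hinto (k - (i + 1)) (by omega)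
          (by rwa [show i + 2 + (k - (i + 1)) = k + 1 by omega])
        rwa [show i + 1 + (k - (i + 1)) = k by omega] at this
    have hIF : ∀ k ∈ I, A (x i) (x (k + 1)) := by
      intro k hk
      obtain ⟨h1, h2, h3⟩ := hIlt k hk
      rcases Nat.lt_or_ge k (m - 1) with h | h
      · have := hfrom (k - (i + 1)) (by omega)
          (by rwa [show i + 1 + (k - (i + 1)) = k by omega])
        rwa [show i + 2 + (k - (i + 1)) = k + 1 by omega] at this
      · rw [show k + 1 = m by omega, hx0]
        exact T.from_lt 0 (by omega)
    have hqmiss : ∀ k ∈ O, ¬A (x q) (x (k + 1)) := by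
      intro k hk hA
      obtain ⟨h1, h2, h3⟩ := hOlt k hk
      exact hxch (j := q) (l := k) (by omega) (by omega) hqL (hOW k hk) hA
    have hpmiss : ∀ k ∈ I, ¬A (x k) (x (p + 1)) := by
      intro k hk hA
      obtain ⟨h1, h2, h3⟩ := hIlt k hk
      refine L.not_exchange (z := z) (q := p + 1) (i := i) (l := k) (by omega) (by omega)
        (by omega) ?_ T.leaves_succ hA (hIF k hk)
      rw [show p + 1 + m - 1 = p + m by omega, L.periodic]
      exact hE.2 hpE
    have hqz : ¬A (x q) z := hqπ ▸ H.not_adj (x q)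
    have hzp : ¬A z (x (p + 1)) := hpπ ▸ H.not_adj z
    have c1 := card_out_add_card_le (A := A) (u := x q)
      (F := insert (x q) (insert z (O.image fun k => x (k + 1)))) (by
        simp only [mem_insert, mem_image]
        rintro w (rfl | rfl | ⟨k, hk, rfl⟩)
        · exact H.irrefl _
        · exact hqz
        · exact hqmiss k hk)
    rw [card_insert_of_notMem, card_insert_of_notMem, card_image_of_injOn] at c1
    rotate_left
    · intro a ha b hb e
      have := hOlt a ha
      have := hOlt b hb
      exact (L.shift 1).inj a (by omega) b (by omega) e
    · simp only [mem_image, not_exists, not_and]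
      exact fun k _ => hxz _
    · simp only [mem_insert, mem_image, not_or, not_exists, not_and]
      refine ⟨hxz _, fun k hk e => ?_⟩
      have := hOlt k hk
      have := L.inj _ (by omega) _ (by omega) e
      omega
    have c2 := card_in_add_card_le (A := A) (v := x (p + 1))
      (F := insert (x (p + 1)) (insert z (I.image x))) (by
        simp only [mem_insert, mem_image]
        rintro w (rfl | rfl | ⟨k, hk, rfl⟩)
        · exact H.irrefl _
        · exact hzp
        · exact hpmiss k hk)
    rw [card_insert_of_notMem, card_insert_of_notMem, card_image_of_injOn] at c2
    rotate_left
    · intro a ha b hb e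
      exact L.inj a (hIlt a ha).2.1 b (hIlt b hb).2.1 e
    · simp only [mem_image, not_exists, not_and]
      exact fun k _ => hxz _
    · simp only [mem_insert, mem_image, not_or, not_exists, not_and]
      refine ⟨hxz _, fun k hk e => ?_⟩
      have := hIlt k hk
      have := L.inj _ (by omega) _ (by omega) e
      omega
    have hvO : i + 1 + j ∈ O :=
      (hOmem _).2 ⟨by omega, by omega, by rwa [show i + 1 + j + 1 = i + 2 + j by omega]⟩
    have hvI : i + 2 + j ∈ I :=
      (hImem _).2 ⟨by omega, by omega, by rwa [show i + 2 + j = i + 1 + (j + 1) by omega]⟩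
    -- The arcs missed by `x q` make the in-degree of `v` at least `#O + 2`, one more than the
    -- out-degree of `z`. Likewise `o2` makes its out-degree at least `#I + 2`, one more than the
    -- in-degree of `z`.
    have o1 := H.ore (x q) (x (i + 2 + j))
      (fun e => by have := L.inj _ (by omega) _ (by omega) e; omega)
      (by have := hqmiss _ hvO; rwa [show i + 1 + j + 1 = i + 2 + j by omega] at this)
      (by rw [hqπ]; exact (hxz _).symm)
    have o2 := H.ore (x (i + 2 + j)) (x (p + 1))
      (fun e => by have := L.inj _ (by omega) _ (by omega) e; omega)
      (hpmiss _ hvI) (by rw [← hpπ]; exact fun e => hxz _ (π.injective e))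
    omega

end IsLongestCycle

/-! ### Existence of a Hamiltonian cycle -/

theorem IsOreOff.exists_adj (H : IsOreOff A π) (u : V) : ∃ v, A u v := by
  have h := H.two_le_card_leaving (T := {u}) (singleton_nonempty u)
    (by rw [card_compl, card_singleton]; have := H.card; omega)
  obtain ⟨v, hv⟩ := card_pos.1 (Nat.lt_of_lt_of_le Nat.zero_lt_two h)
  rw [mem_filter] at hv
  obtain ⟨-, t, ht, h⟩ := hv
  exact ⟨v, by rwa [mem_singleton.1 ht] at h⟩

/-- Iterating a choice of out-neighbour eventually repeats; a minimal period gives a cycle without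
repeated vertices. -/
theorem exists_isCyclicWalk [Nonempty V] (h : ∀ u, ∃ v, A u v) :
    ∃ m x, IsCyclicWalk A m x := by
  choose f hf using h
  obtain ⟨u⟩ := ‹Nonempty V›
  obtain ⟨a, b, hab, e⟩ := Finite.exists_ne_map_eq_of_infinite fun k : ℕ => f^[k] u
  wlog hlt : a < b generalizing a b
  · exact this b a hab.symm e.symm (by omega)
  have hper : Function.IsPeriodicPt f (b - a) (f^[a] u) := by
    rw [Function.IsPeriodicPt, Function.IsFixedPt, ← Function.iterate_add_apply,
      Nat.sub_add_cancel hlt.le]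
    exact e.symm
  refine ⟨Function.minimalPeriod f (f^[a] u), fun k => f^[k] (f^[a] u),
    hper.minimalPeriod_pos (by omega), fun k => ?_, fun k => ?_, fun j hj k hk e => ?_⟩
  · rw [Function.iterate_add_apply, Function.iterate_minimalPeriod]
  · rw [Function.iterate_succ_apply']
    exact hf _
  · exact Function.iterate_injOn_Iio_minimalPeriod hj hk e

theorem IsCyclicWalk.le_card {m : ℕ} {x : ℕ → V} (h : IsCyclicWalk A m x) :
    m ≤ Fintype.card V := by
  rw [← Fintype.card_fin m]
  exact Fintype.card_le_of_injective (fun i : Fin m => x i)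
    fun i j e => Fin.ext (h.inj _ i.2 _ j.2 e)

theorem IsOreOff.exists_spanning (H : IsOreOff A π) :
    ∃ x, IsCyclicWalk A (Fintype.card V) x := by
  have : Nonempty V := Fintype.card_pos_iff.1 (by have := H.card; omega)
  obtain ⟨m₀, x₀, h₀⟩ := exists_isCyclicWalk H.exists_adj
  set P : ℕ → Prop := fun m => ∃ x, IsCyclicWalk A m x with hP
  obtain ⟨x, hx⟩ : P (Nat.findGreatest P (Fintype.card V)) :=
    Nat.findGreatest_spec h₀.le_card ⟨x₀, h₀⟩
  have hmax : ∀ m' y, IsCyclicWalk A m' y → m' ≤ Nat.findGreatest P (Fintype.card V) :=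
    fun m' y h => Nat.le_findGreatest h.le_card ⟨y, h⟩
  set m := Nat.findGreatest P (Fintype.card V)
  by_contra hcon
  have hlt : m < Fintype.card V := lt_of_le_of_ne hx.le_card fun e => hcon ⟨x, e ▸ hx⟩
  have hlong : ∀ y, IsCyclicWalk A m y → IsLongestCycle A {v | ∃ k, y k = v} m y :=
    fun y hy => ⟨hy, by simp, hmax⟩
  set S : Finset V := {z | ∃ y, IsCyclicWalk A m y ∧ ∀ k, y k ≠ z}
  have hS : S.Nonempty := by
    obtain ⟨z, -, hz⟩ := exists_mem_notMem_of_card_lt_card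
      (s := {v | ∃ k, x k = v}) (t := univ) (by rwa [(hlong x hx).card_eq, card_univ])
    exact ⟨z, by simpa [S] using ⟨x, hx, by simpa using hz⟩⟩
  -- The maximum is over the vertices missed by any longest cycle, not by one fixed cycle, since the
  -- exchange changes the cycle.
  obtain ⟨z, hz, hzmax⟩ := S.exists_max_image (fun z => #{w | A z w} + #{w | A w z}) hS
  obtain ⟨y, hy, hyz⟩ : ∃ y, IsCyclicWalk A m y ∧ ∀ k, y k ≠ z := by simpa [S] using hz
  have hzC : z ∉ ({v | ∃ k, y k = v} : Finset V) := by simpa using hyz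
  obtain ⟨y', i, g, hm, L, T⟩ := (hlong y hy).exists_isTight H hzC
  obtain ⟨v, y'', h₁, h₂, h₃⟩ := T.exists_larger L H hzC hm
  have := hzmax v (by simpa [S] using ⟨y'', h₁, h₂⟩)
  omega

theorem IsOreOff.exists_equiv (H : IsOreOff A π) :
    ∃ e : Fin (Fintype.card V) ≃ V, ∀ i, A (e i) (e (finRotate _ i)) := by
  obtain ⟨x, hx⟩ := H.exists_spanning
  have hinj : Function.Injective fun i : Fin (Fintype.card V) => x i :=
    fun i j e => Fin.ext (hx.inj _ i.2 _ j.2 e)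
  refine ⟨Equiv.ofBijective _ ((Fintype.bijective_iff_injective_and_card _).2 ⟨hinj, by simp⟩),
    fun i => ?_⟩
  have key : ∀ (n : ℕ) (i : Fin n), (finRotate n i : ℕ) = (i + 1) % n := by
    intro n i
    cases n with
    | zero => exact i.elim0
    | succ n => rw [finRotate_apply, Fin.val_add, Fin.val_one', Nat.add_mod_mod]
  simp only [Equiv.ofBijective_apply]
  rw [key, hx.apply_mod]
  exact hx.adj i

end OreCondition

/-! ### Two arc-disjoint Hamiltonian cycles -/

section Main

open Finset
open scoped Classical

variable {V : Type*} [Fintype V]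

/-- The successor map along the cyclic enumeration `e`. -/
def cyclicSucc {n : ℕ} (e : Fin n ≃ V) : Equiv.Perm V := (e.symm.trans (finRotate n)).trans e

omit [Fintype V] in
theorem cyclicSucc_ne {n : ℕ} (hn : 2 ≤ n) (e : Fin n ≃ V) (v : V) : cyclicSucc e v ≠ v := by
  obtain ⟨k, rfl⟩ := Nat.exists_eq_add_of_le' hn
  have h : e.symm v ∈ (finRotate (k + 2)).support := by rw [support_finRotate]; exact mem_univ _
  rw [Equiv.Perm.mem_support] at h
  intro h'
  exact h (e.injective (by simpa [cyclicSucc] using h'))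

theorem outDeg_eq (D : Digraph V) (v : V) : D.outDeg v = #{w | D.Adj v w} := by
  rw [outDeg, ← Set.ncard_coe_finset]
  simp

theorem inDeg_eq (D : Digraph V) (v : V) : D.inDeg v = #{u | D.Adj u v} := by
  rw [inDeg, ← Set.ncard_coe_finset]
  simp

theorem card_filter_le_of_ne (P : V → Prop) (a : V) : #{w | P w} ≤ #{w | P w ∧ a ≠ w} + 1 := by
  refine (card_le_card fun w hw => ?_).trans (card_insert_le a _)
  rw [mem_insert]
  by_cases h : a = w
  · exact Or.inl h.symm
  · exact Or.inr (by simpa [h] using hw)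

theorem isOreOff_of_degrees {D : Digraph V} (hD : D.IsSimple) (hn : 4 ≤ Fintype.card V)
    (hdeg : ∀ u v : V, u ≠ v → ¬D.Adj u v → Fintype.card V + 2 ≤ D.outDeg u + D.inDeg v)
    {π : Equiv.Perm V} (hπ : ∀ v, π v ≠ v) :
    IsOreOff (fun u v => D.Adj u v ∧ π u ≠ v) π where
  card := hn
  irrefl v h := hD v h.1
  ne := hπ
  not_adj v h := h.2 rfl
  ore u v huv h hp := by
    have h1 := hdeg u v huv fun h' => h ⟨h', hp⟩
    rw [outDeg_eq, inDeg_eq] at h1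
    have h2 := card_filter_le_of_ne (fun w => D.Adj u w) (π u)
    have h3 := card_filter_le_of_ne (fun w => D.Adj w v) (π⁻¹ v)
    have h4 : ∀ w, π⁻¹ v ≠ w ↔ π w ≠ v := fun w => by
      rw [Ne, Equiv.Perm.inv_eq_iff_eq, eq_comm]
    simp only [h4] at h3
    have h5 : Fintype.card V ≤
        #{w | D.Adj u w ∧ π u ≠ w} + #{w | D.Adj w v ∧ π w ≠ v} := by omega
    convert h5

/-- Without loops the two degrees are at most `n - 1`, and `n + 2 ≤ 2 * (n - 1)` fails for `n ≤ 3`.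
-/
theorem adj_of_card_le_three {D : Digraph V} (hD : D.IsSimple) (hn : Fintype.card V ≤ 3)
    (hdeg : ∀ u v : V, u ≠ v → ¬D.Adj u v → Fintype.card V + 2 ≤ D.outDeg u + D.inDeg v)
    {u v : V} (huv : u ≠ v) : D.Adj u v := by
  by_contra h
  have h1 := hdeg u v huv h
  rw [outDeg_eq, inDeg_eq] at h1
  have h2 : #{w | D.Adj u w} < Fintype.card V :=
    card_lt_univ_of_notMem (x := u) (by simpa using hD u)
  have h3 : #{w | D.Adj w v} < Fintype.card V :=
    card_lt_univ_of_notMem (x := v) (by simpa using hD v)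
  omega

theorem isHamiltonianCycle_range {D : Digraph V} (e : Fin (Fintype.card V) ≃ V)
    (h : ∀ i, D.Adj (e i) (e (finRotate _ i))) :
    D.IsHamiltonianCycle (Set.range fun i => (e i, e (finRotate _ i))) := by
  refine ⟨?_, e, rfl⟩
  rintro _ ⟨i, rfl⟩
  exact h i

end Main

end Digraph

open Digraph in
theorem mainTheorem5 {V : Type*} [Fintype V] (D : Digraph V) (hD : D.IsSimple)
    (hn : 2 < Fintype.card V)
    (hdeg : ∀ u v : V, u ≠ v → ¬ D.Adj u v → Fintype.card V + 2 ≤ D.outDeg u + D.inDeg v) :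
    ∃ C₁ C₂ : Set (V × V),
      D.IsHamiltonianCycle C₁ ∧ D.IsHamiltonianCycle C₂ ∧ Disjoint C₁ C₂ := by
  have e₀ := (Fintype.equivFin V).symm
  have hne : ∀ (e : Fin (Fintype.card V) ≃ V) v, cyclicSucc e v ≠ v :=
    cyclicSucc_ne (by omega)
  have hsucc : ∀ (e : Fin (Fintype.card V) ≃ V) i, cyclicSucc e (e i) = e (finRotate _ i) :=
    fun e i => by simp [cyclicSucc]
  rcases Nat.lt_or_ge 3 (Fintype.card V) with h3 | h3
  · obtain ⟨e₁, h₁⟩ := (isOreOff_of_degrees hD h3 hdeg (hne e₀)).exists_equiv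
    obtain ⟨e₂, h₂⟩ := (isOreOff_of_degrees hD h3 hdeg (hne e₁)).exists_equiv
    refine ⟨_, _, isHamiltonianCycle_range e₁ fun i => (h₁ i).1,
      isHamiltonianCycle_range e₂ fun i => (h₂ i).1, ?_⟩
    rw [Set.disjoint_left]
    rintro _ ⟨i, rfl⟩ ⟨j, hj⟩
    rw [Prod.mk.injEq] at hj
    apply (h₂ j).2
    rw [hj.1, hj.2, hsucc]
  · have hadj : ∀ (e : Fin (Fintype.card V) ≃ V) i, D.Adj (e i) (e (finRotate _ i)) := fun e i =>
      adj_of_card_le_three hD h3 hdeg (by rw [← hsucc]; exact (hne e _).symm)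
    -- For `n = 3` the digraph is complete, and the two orientations of the triangle serve.
    refine ⟨_, _, isHamiltonianCycle_range e₀ (hadj e₀),
      isHamiltonianCycle_range (Fin.revPerm.trans e₀) (hadj _), ?_⟩
    have key : ∀ n, n = 3 → ∀ j : Fin n, finRotate n j.rev ≠ (finRotate n j).rev := by
      rintro n rfl
      decide
    rw [Set.disjoint_left]
    rintro _ ⟨i, rfl⟩ ⟨j, hj⟩
    simp only [Equiv.trans_apply, Fin.revPerm_apply, Prod.mk.injEq, EmbeddingLike.apply_eq_iff_eq]
      at hj
    exact key _ (by omega) j (by rw [hj.1, hj.2])
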